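/- Work on the hypercube $\{0,1\}^n$ with Hamming distance $d$ and the uniform distribution $U_n$. $\mathsf{CONJUNCTIONS}$ is the class of all conjunctions of sets of literals over $x_1,\dots,x_n$. For a budget $\rho(n)\ge 0$, the (exact-in-the-ball) robust risk of a hypothesis $h$ against a target $c$ is $\mathsf R_\rho(h,c)=\Pr_{x\sim U_n}[\exists z:\ d(x,z)\le\rho(n),\ c(z)\ne h(z)]$. A learner with $\mathsf{EX}$ and $\lambda$-$\mathsf{LMQ}$ access is a (possibly randomized and adaptive) procedure that draws uniform random examples labelled by the target $c$, queries the value of $c$ at points at distance at most $\lambda(n)$ from examples it has drawn, and outputs a hypothesis $h:\{0,1\}^n\to\{0,1\}$. It is a sample-efficient $\rho$-robust learner if for all $n$, all $\epsilon,\delta>0$ and all $c\in\mathsf{CONJUNCTIONS}$ it outputs $h$ with $\mathsf R_\rho(h,c)\le\epsilon$ with probability at least $1-\delta$, using numbers of examples and of queries that are bounded by a polynomial in $n,1/\epsilon,1/\delta$. A budget function $\rho:\mathbb N\to\mathbb R_{\ge0}$ is a robustness threshold if a sample-efficient $\rho$-robust learner exists, while for no $\rho'=\omega(\rho)$ does a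 sample-efficient $\rho'$-robust learner exist. The robustness threshold of $\mathsf{CONJUNCTIONS}$ under the uniform distribution with access to $\mathsf{EX}$ and $\mathsf{LMQ}$ is $\Theta(\log n)$. That is: 1. For every query radius $\lambda:\mathbb N\to\mathbb R$, every $\rho:\mathbb N\to\mathbb R_{\ge0}$ with $\rho(n)=\Theta(\log n)$ is a robustness threshold. Moreover, for such $\rho$ there is a $\rho$-robust learner that is a single program of a random access machine, runs in time polynomial in $n,1/\epsilon,1/\delta$, and outputs an explicitly given conjunction (so that its hypotheses are polynomially evaluable). 2. Budgets $\omega(\log n)$ force superpolynomial sample/query complexity, for any query radius: there are absolute constants $\epsilon,\delta>0$ such that for every $\rho:\mathbb N\to\mathbb R_{\ge0}$ with $\rho(n)=\omega(\log n)$, every $k\in\mathbb N$ and all sufficiently large $n$, no learner on $\{0,1\}^n$, even with membership queries at arbitrary points, that for every target in $\mathsf{CONJUNCTIONS}$ outputs $h$ with $\mathsf R_\rho(h,c)\le\epsilon$ with probability at least $1-\delta$ uses at most $n^k$ examples and at most $n^k$ queries on every target. -/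

import Mathlib

open Filter Asymptotics

noncomputable section

namespace RobustLearning

/-- The boolean hypercube `{0,1}^n`; its metric is the Hamming distance. -/
abbrev Cube (n : ℕ) : Type := Fin n → Bool

/-- Concepts and hypotheses on `{0,1}^n`. -/
abbrev BoolFun (n : ℕ) : Type := Cube n → Bool

/-- The conjunction of a set of literals; `(i, true)` is the literal `x_i` and `(i, false)` is the
literal `¬ x_i`. -/
def conj {n : ℕ} (L : Set (Fin n × Bool)) : BoolFun n := by
  classical
  exact fun x => decide (∀ l ∈ L, x l.1 = l.2)

/-- The class CONJUNCTIONS on `{0,1}^n`. -/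
def Conjunctions (n : ℕ) : Set (BoolFun n) := {c | ∃ L : Set (Fin n × Bool), c = conj L}

/-- The uniform distribution on `{0,1}^n`. -/
def uniform (n : ℕ) : PMF (Cube n) := PMF.uniformOfFintype (Cube n)

/-- The exact-in-the-ball robust risk `P_{x ∼ D}[∃ z ∈ B_r(x), c(z) ≠ h(z)]`. -/
def robustRisk {n : ℕ} (D : PMF (Cube n)) (r : ℝ) (h c : BoolFun n) : ENNReal :=
  D.toOuterMeasure {x | ∃ z, (hammingDist x z : ℝ) ≤ r ∧ c z ≠ h z}

/-- A (possibly randomized, adaptive) procedure that interacts with the example oracle `EX` and a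
membership query oracle and then returns an element of `α`. It may stop, draw a labelled example,
query the label of a point, or use internal randomness. -/
inductive Interaction (n : ℕ) (α : Type) : Type
  | ret (a : α) : Interaction n α
  | draw (k : Cube n → Bool → Interaction n α) : Interaction n α
  | query (x : Cube n) (k : Bool → Interaction n α) : Interaction n α
  | random (μ : PMF ℕ) (k : ℕ → Interaction n α) : Interaction n α

namespace Interaction

variable {n : ℕ} {α β : Type}

/-- Sequential composition. -/
def bind : Interaction n α → (α → Interaction n β) → Interaction n β
  | ret a, f => f a
  | draw k, f => draw fun x y => (k x y).bind f
  | query x k, f => query x fun y => (k y).bind f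
  | random μ k, f => random μ fun i => (k i).bind f

/-- The law of the returned value when the target is `c` and examples are drawn independently
from `D`. -/
def law (D : PMF (Cube n)) (c : BoolFun n) : Interaction n α → PMF α
  | ret a => PMF.pure a
  | draw k => D.bind fun x => (k x (c x)).law D c
  | query x k => (k (c x)).law D c
  | random μ k => μ.bind fun i => (k i).law D c

/-- Against the target `c`, at most `m` examples are drawn on every run. -/
def ExamplesAtMost (c : BoolFun n) : Interaction n α → ℕ → Prop
  | ret _, _ => True
  | draw k, m => ∃ m', m = m' + 1 ∧ ∀ x, (k x (c x)).ExamplesAtMost c m'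
  | query x k, m => (k (c x)).ExamplesAtMost c m
  | random μ k, m => ∀ i ∈ μ.support, (k i).ExamplesAtMost c m

/-- Against the target `c`, at most `q` membership queries are made on every run. -/
def QueriesAtMost (c : BoolFun n) : Interaction n α → ℕ → Prop
  | ret _, _ => True
  | draw k, q => ∀ x, (k x (c x)).QueriesAtMost c q
  | query x k, q => ∃ q', q = q' + 1 ∧ (k (c x)).QueriesAtMost c q'
  | random μ k, q => ∀ i ∈ μ.support, (k i).QueriesAtMost c q

/-- Against the target `c`, every membership query is within Hamming distance `r` of an example
that has been drawn (`S` is the set of points drawn so far). -/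
def IsLocal (c : BoolFun n) (r : ℝ) : Interaction n α → Set (Cube n) → Prop
  | ret _, _ => True
  | draw k, S => ∀ x, (k x (c x)).IsLocal c r (insert x S)
  | query x k, S => (∃ y ∈ S, (hammingDist y x : ℝ) ≤ r) ∧ (k (c x)).IsLocal c r S
  | random μ k, S => ∀ i ∈ μ.support, (k i).IsLocal c r S

/-- Against the target `c`, every returned value satisfies `P`. -/
def Always (c : BoolFun n) (P : α → Prop) : Interaction n α → Prop
  | ret a => P a
  | draw k => ∀ x, (k x (c x)).Always c P
  | query x k => (k (c x)).Always c P
  | random μ k => ∀ i ∈ μ.support, (k i).Always c P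

end Interaction

/-- A learner on `{0,1}^n` with `EX` and membership query access, seen information-theoretically:
no computational restriction. It returns an arbitrary hypothesis. -/
abbrev Learner (n : ℕ) : Type := Interaction n (BoolFun n)

/-- Against the target `c`, the learner `A` outputs with probability at least `1 - δ` a hypothesis
of robust risk at most `ε` for the budget `r`. -/
def Succeeds {n : ℕ} (D : PMF (Cube n)) (r ε δ : ℝ) (c : BoolFun n) (A : Learner n) : Prop :=
  ENNReal.ofReal (1 - δ) ≤
    (A.law D c).toOuterMeasure {h | robustRisk D r h c ≤ ENNReal.ofReal ε}

/-- The value of the polynomial `p` at `(n, ⌈1/ε⌉, ⌈1/δ⌉)`. Being bounded by such a value is the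
same as being bounded by a polynomial in `n`, `1/ε`, `1/δ`. -/
def polyBound (p : MvPolynomial (Fin 3) ℕ) (n : ℕ) (ε δ : ℝ) : ℕ :=
  MvPolynomial.eval ![n, ⌈1 / ε⌉₊, ⌈1 / δ⌉₊] p

/-- The class `C` is `ρ`-robustly learnable under the distributions `D` with `EX` and `lam`-local
membership queries, with polynomial sample and query complexity. -/
def SampleEfficientlyLearnable (D : ∀ n, PMF (Cube n)) (C : ∀ n, Set (BoolFun n))
    (lam ρ : ℕ → ℝ) : Prop :=
  ∃ (A : ∀ n : ℕ, ℝ → ℝ → Learner n) (p : MvPolynomial (Fin 3) ℕ),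
    ∀ (n : ℕ) (ε δ : ℝ), 0 < ε → 0 < δ → ∀ c ∈ C n,
      (A n ε δ).ExamplesAtMost c (polyBound p n ε δ) ∧
      (A n ε δ).QueriesAtMost c (polyBound p n ε δ) ∧
      (A n ε δ).IsLocal c (lam n) ∅ ∧
      Succeeds (D n) (ρ n) ε δ c (A n ε δ)

/-- `ρ` is a robustness threshold: budget `ρ` admits a sample-efficient robust learner, and no
budget `ω(ρ)` does. -/
def IsRobustnessThreshold (D : ∀ n, PMF (Cube n)) (C : ∀ n, Set (BoolFun n))
    (lam ρ : ℕ → ℝ) : Prop :=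
  SampleEfficientlyLearnable D C lam ρ ∧
    ∀ ρ' : ℕ → ℝ, (∀ n, 0 ≤ ρ' n) → ρ =o[atTop] ρ' → ¬ SampleEfficientlyLearnable D C lam ρ'

/-! ### A random access machine with oracles and a step count -/

/-- Programs of a random access machine with registers and a heap, both holding natural numbers.
The only control structures are `seq`, `ifz` and `loop`, so every program halts. The arithmetic
operations are constants, addition and truncated subtraction, so that after `t` steps all numbers
have `O(t)` bits more than the input and the program text, and the unit-cost step count below is
polynomially related to Turing machine time. -/
inductive Prog : Type
  | const (r k : ℕ) : Prog
  | copy (r a : ℕ) : Prog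
  | add (r a b : ℕ) : Prog
  | sub (r a b : ℕ) : Prog
  | load (r a : ℕ) : Prog
  | store (a b : ℕ) : Prog
  | coin (r : ℕ) : Prog
  | ex (a r : ℕ) : Prog
  | mq (a r : ℕ) : Prog
  | seq (P Q : Prog) : Prog
  | ifz (r : ℕ) (P Q : Prog) : Prog
  | loop (r : ℕ) (P : Prog) : Prog

/-- A machine state; `time` is the number of steps made so far. -/
structure State where
  reg : ℕ → ℕ
  heap : ℕ → ℕ
  time : ℕ

namespace State

/-- Advance the clock by `t` steps. -/
def tick (s : State) (t : ℕ) : State := { s with time := s.time + t }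

/-- Write `v` to register `r`. -/
def setReg (s : State) (r v : ℕ) : State := { s with reg := Function.update s.reg r v }

/-- Write `v` to heap cell `a`. -/
def setHeap (s : State) (a v : ℕ) : State := { s with heap := Function.update s.heap a v }

/-- Write the bits of the point `x` to the heap cells `a, …, a + n - 1`. -/
def writePoint {n : ℕ} (s : State) (a : ℕ) (x : Cube n) : State :=
  { s with heap := fun j =>
      if h : a ≤ j ∧ j < a + n then (x ⟨j - a, by omega⟩).toNat else s.heap j }

/-- The point whose bits are in the heap cells `a, …, a + n - 1` (nonzero means `1`). -/
def readPoint (s : State) (n a : ℕ) : Cube n := fun i => decide (s.heap (a + i) ≠ 0)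

/-- The initial state: registers `0, 1, 2` hold the inputs, everything else is `0`. -/
def init (n a b : ℕ) : State where
  reg := fun r => if r = 0 then n else if r = 1 then a else if r = 2 then b else 0
  heap := fun _ => 0
  time := 0

/-- The hypothesis that a state represents: the conjunction of the literals `(i, b)` for which heap
cell `2 i + b` is nonzero. In this representation a hypothesis is evaluated in time `O(n)`. -/
def hypothesis (s : State) (n : ℕ) : BoolFun n :=
  conj {l : Fin n × Bool | s.heap (2 * (l.1 : ℕ) + l.2.toNat) ≠ 0}

end State

/-- The execution of a program in dimension `n`. Every instruction costs one step, except that an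
oracle call costs `n + 1` steps; each round of a loop costs one step more than its body. -/
def Prog.exec (n : ℕ) : Prog → State → Interaction n State
  | const r k, s => .ret ((s.setReg r k).tick 1)
  | copy r a, s => .ret ((s.setReg r (s.reg a)).tick 1)
  | add r a b, s => .ret ((s.setReg r (s.reg a + s.reg b)).tick 1)
  | sub r a b, s => .ret ((s.setReg r (s.reg a - s.reg b)).tick 1)
  | load r a, s => .ret ((s.setReg r (s.heap (s.reg a))).tick 1)
  | store a b, s => .ret ((s.setHeap (s.reg a) (s.reg b)).tick 1)
  | coin r, s => .random ((PMF.uniformOfFintype (Fin 2)).map Fin.val) fun i =>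
      .ret ((s.setReg r i).tick 1)
  | ex a r, s => .draw fun x y =>
      .ret (((s.writePoint (s.reg a) x).setReg r y.toNat).tick (n + 1))
  | mq a r, s => .query (s.readPoint n (s.reg a)) fun y =>
      .ret ((s.setReg r y.toNat).tick (n + 1))
  | seq P Q, s => (P.exec n s).bind (Q.exec n)
  | ifz r P Q, s => if s.reg r = 0 then P.exec n (s.tick 1) else Q.exec n (s.tick 1)
  | loop r P, s => Nat.rec (.ret (s.tick 1))
      (fun _ t => t.bind fun s' => P.exec n (s'.tick 1)) (s.reg r)

/-- The run of a program on the input `(n, ⌈1/ε⌉, ⌈1/δ⌉)`. -/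
def Prog.run (P : Prog) (n : ℕ) (ε δ : ℝ) : Interaction n State :=
  P.exec n (State.init n ⌈1 / ε⌉₊ ⌈1 / δ⌉₊)

/-- The class `C` is `ρ`-robustly learnable under the distributions `D` with `EX` and `lam`-local
membership queries by one program whose running time (hence also the number of oracle calls) is
polynomial in `n`, `1/ε`, `1/δ` and whose hypotheses are explicitly given conjunctions. -/
def PolyTimeLearnable (D : ∀ n, PMF (Cube n)) (C : ∀ n, Set (BoolFun n))
    (lam ρ : ℕ → ℝ) : Prop :=
  ∃ (P : Prog) (p : MvPolynomial (Fin 3) ℕ),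
    ∀ (n : ℕ) (ε δ : ℝ), 0 < ε → 0 < δ → ∀ c ∈ C n,
      (P.run n ε δ).Always c (fun s => s.time ≤ polyBound p n ε δ) ∧
      (P.run n ε δ).IsLocal c (lam n) ∅ ∧
      Succeeds (D n) (ρ n) ε δ c ((P.run n ε δ).bind fun s => .ret (s.hypothesis n))

end RobustLearning

end

open Filter Asymptotics RobustLearning

/-!
Upper bound. The elimination algorithm outputs the conjunction of all literals that are satisfied by
every positive example. Let the target be the conjunction of the literals `L` on `k` variables. The
output contains `L`, so the hypothesis can only err in the ball of `x` if the target accepts a point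
of that ball, that is, if `x` violates at most `ρ` literals of `L`; by the exponential Markov
inequality this has probability at most `2 ^ ρ * (3 / 4) ^ k`. If this is at most `ε`, every
possible output is good. Otherwise `2 ^ k ≤ (2 ^ ρ / ε) ^ 3`, which is polynomial for
`ρ = O(log n)`, and as each literal outside `L` is violated by a positive example with probability
at least `2 ^ (-k - 1)`, polynomially many examples eliminate all of them and the output is the
target itself.

Lower bound. Fix a set `F` of at most `ρ` variables and consider the `2 ^ |F|` conjunctions that
prescribe all values on `F`. Each of them accepts a point of every ball of radius `|F|`, so no
hypothesis is robustly good both for it and for the constant `false` (the conjunction of all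
literals). But a point is accepted by only one of them, so each oracle call can distinguish `false`
from at most one of them. Hence on the order of `2 ^ |F|` calls are needed, for any distribution of
the examples.
-/

namespace RobustLearning

namespace Interaction

variable {n : ℕ} {α β : Type} {c : BoolFun n} {t : Interaction n α} {m : ℕ}
  {Q : List (Cube n) → α → Prop}

/-- Against the target `c`, every run draws exactly `m` examples, uses neither queries nor
randomness, and returns a value that is related by `Q` to the list of the points drawn. -/
inductive DrawSpec (c : BoolFun n) :
    Interaction n α → ℕ → (List (Cube n) → α → Prop) → Prop
  | ret {a : α} {Q : List (Cube n) → α → Prop} (h : Q [] a) : DrawSpec c (.ret a) 0 Q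
  | draw {k : Cube n → Bool → Interaction n α} {m : ℕ} {Q : List (Cube n) → α → Prop}
      (h : ∀ x, DrawSpec c (k x (c x)) m fun l a => Q (x :: l) a) :
      DrawSpec c (.draw k) (m + 1) Q

theorem drawSpec_zero_iff : t.DrawSpec c 0 Q ↔ ∃ a, t = .ret a ∧ Q [] a := by
  constructor
  · rintro (h | _)
    exact ⟨_, rfl, h⟩
  · rintro ⟨a, rfl, h⟩
    exact .ret h

namespace DrawSpec

theorem mono {Q' : List (Cube n) → α → Prop} (h : t.DrawSpec c m Q)
    (hQ : ∀ l a, Q l a → Q' l a) : t.DrawSpec c m Q' := by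
  induction h generalizing Q' with
  | ret h => exact .ret (hQ _ _ h)
  | draw _ ih => exact .draw fun x => ih x fun l => hQ (x :: l)

theorem bind {f : α → Interaction n β} {m' : ℕ} {Q' : List (Cube n) → β → Prop}
    (h : t.DrawSpec c m Q)
    (hf : ∀ l a, Q l a → (f a).DrawSpec c m' fun l' b => Q' (l ++ l') b) :
    (t.bind f).DrawSpec c (m + m') Q' := by
  induction h generalizing Q' with
  | ret h => simpa [Interaction.bind] using hf _ _ h
  | draw _ ih =>
    rw [Nat.succ_add]
    exact .draw fun x => ih x fun l => hf (x :: l)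

theorem always {P : α → Prop} (h : t.DrawSpec c m Q) (hP : ∀ l a, Q l a → P a) :
    t.Always c P := by
  induction h with
  | ret h => exact hP _ _ h
  | draw _ ih => exact fun x => ih x fun l => hP (x :: l)

theorem isLocal (h : t.DrawSpec c m Q) (r : ℝ) (S : Set (Cube n)) : t.IsLocal c r S := by
  induction h generalizing S with
  | ret _ => trivial
  | draw _ ih => exact fun x => ih x _

theorem queriesAtMost (h : t.DrawSpec c m Q) (q : ℕ) : t.QueriesAtMost c q := by
  induction h with
  | ret _ => trivial
  | draw _ ih => exact ih

theorem examplesAtMost (h : t.DrawSpec c m Q) : t.ExamplesAtMost c m := by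
  induction h with
  | ret _ => trivial
  | draw _ ih => exact ⟨_, rfl, ih⟩

end DrawSpec

end Interaction

section Samples

variable {α : Type*}

/-- The law of a list of `m` independent samples from `D`. -/
noncomputable def samples (D : PMF α) : ℕ → PMF (List α)
  | 0 => PMF.pure []
  | m + 1 => D.bind fun x => (samples D m).map (x :: ·)

theorem samples_succ_apply (D : PMF α) (m : ℕ) (G : Set (List α)) :
    (samples D (m + 1)).toOuterMeasure G =
      ∑' x, D x * (samples D m).toOuterMeasure {l | x :: l ∈ G} := by
  simp only [samples, PMF.toOuterMeasure_bind_apply, PMF.toOuterMeasure_map_apply, Set.preimage]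

theorem samples_forall_mem (D : PMF α) (S : Set α) (m : ℕ) :
    (samples D m).toOuterMeasure {l | ∀ x ∈ l, x ∈ S} = D.toOuterMeasure S ^ m := by
  classical
  induction m with
  | zero => simp [samples, PMF.toOuterMeasure_pure_apply]
  | succ m ih =>
    rw [samples_succ_apply, pow_succ', PMF.toOuterMeasure_apply, ← ENNReal.tsum_mul_right]
    refine tsum_congr fun x => ?_
    by_cases hx : x ∈ S <;> simp [hx, ih, PMF.toOuterMeasure_apply]

end Samples

theorem Interaction.DrawSpec.le_law {n : ℕ} {α : Type} {c : BoolFun n} {t : Interaction n α}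
    {m : ℕ} {Q : List (Cube n) → α → Prop} (h : t.DrawSpec c m Q) (D : PMF (Cube n))
    {G : Set (List (Cube n))} {E : Set α} (hE : ∀ l a, Q l a → l ∈ G → a ∈ E) :
    (samples D m).toOuterMeasure G ≤ (t.law D c).toOuterMeasure E := by
  classical
  induction h generalizing G with
  | @ret a Q h =>
    simp only [samples, Interaction.law, PMF.toOuterMeasure_pure_apply]
    by_cases hG : [] ∈ G
    · rw [if_pos hG, if_pos (hE _ _ h hG)]
    · rw [if_neg hG]
      exact zero_le
  | draw _ ih =>
    rw [samples_succ_apply, Interaction.law, PMF.toOuterMeasure_bind_apply]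
    exact ENNReal.tsum_le_tsum fun x => mul_le_mul_right (ih x fun l => hE (x :: l)) _

section Probability

variable {α : Type*} (p : PMF α) (s : Set α)

theorem toOuterMeasure_add_compl : p.toOuterMeasure s + p.toOuterMeasure sᶜ = 1 := by
  simp only [PMF.toOuterMeasure_apply, ← ENNReal.tsum_add, Set.indicator_self_add_compl_apply,
    p.tsum_coe]

theorem toOuterMeasure_le_one : p.toOuterMeasure s ≤ 1 :=
  le_self_add.trans_eq (toOuterMeasure_add_compl p s)

variable {p s} {δ : ℝ}

theorem ofReal_one_sub_le_toOuterMeasure (hδ : 0 ≤ δ)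
    (h : p.toOuterMeasure sᶜ ≤ ENNReal.ofReal δ) :
    ENNReal.ofReal (1 - δ) ≤ p.toOuterMeasure s := by
  rw [ENNReal.ofReal_sub _ hδ, ENNReal.ofReal_one, tsub_le_iff_right,
    ← toOuterMeasure_add_compl p s]
  gcongr

theorem toOuterMeasure_compl_le (h : ENNReal.ofReal (1 - δ) ≤ p.toOuterMeasure s) :
    p.toOuterMeasure sᶜ ≤ ENNReal.ofReal δ := by
  have hne : p.toOuterMeasure s ≠ ⊤ := ne_top_of_le_ne_top (by simp) (toOuterMeasure_le_one p s)
  refine (ENNReal.add_le_add_iff_left hne).1 ?_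
  calc p.toOuterMeasure s + p.toOuterMeasure sᶜ = ENNReal.ofReal (1 - δ + δ) := by
        rw [toOuterMeasure_add_compl, sub_add_cancel, ENNReal.ofReal_one]
    _ ≤ ENNReal.ofReal (1 - δ) + ENNReal.ofReal δ := ENNReal.ofReal_add_le
    _ ≤ p.toOuterMeasure s + ENNReal.ofReal δ := by gcongr

theorem sum_toOuterMeasure_bind_le {ι β γ : Type*} [Fintype ι] (p : PMF β) (f g : ι → β → PMF γ)
    (E : ι → Set γ) (C : ENNReal)
    (h : ∀ b ∈ p.support,
      ∑ s, (f s b).toOuterMeasure (E s) ≤ ∑ s, (g s b).toOuterMeasure (E s) + C) :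
    ∑ s, (p.bind (f s)).toOuterMeasure (E s) ≤ ∑ s, (p.bind (g s)).toOuterMeasure (E s) + C := by
  simp only [PMF.toOuterMeasure_bind_apply, ← Summable.tsum_finsetSum fun _ _ => ENNReal.summable,
    ← Finset.mul_sum]
  calc ∑' b, p b * ∑ s, (f s b).toOuterMeasure (E s)
      ≤ ∑' b, p b * (∑ s, (g s b).toOuterMeasure (E s) + C) := by
        refine ENNReal.tsum_le_tsum fun b => ?_
        rcases eq_or_ne (p b) 0 with hb | hb
        · simp only [hb, zero_mul, le_refl]
        · exact mul_le_mul_right (h b hb) _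
    _ = ∑' b, p b * ∑ s, (g s b).toOuterMeasure (E s) + C := by
        simp only [mul_add, ENNReal.tsum_add, ENNReal.tsum_mul_right, p.tsum_coe, one_mul]

end Probability

/-! ### The elimination algorithm on the random access machine -/

section Loops

variable {n : ℕ} {c : BoolFun n} {P : Prog} {m τ r : ℕ} {s : State}

theorem drawSpec_loop (I : ℕ → List (Cube n) → State → Prop)
    (htick : ∀ j l s t, I j l s → I j l (s.tick t)) (h0 : I 0 [] s)
    (hstep : ∀ j < s.reg r, ∀ l s', I j l s' → (P.exec n s').DrawSpec c m
      fun l' s'' => I (j + 1) (l ++ l') s'' ∧ s''.time ≤ s'.time + τ) :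
    ((Prog.loop r P).exec n s).DrawSpec c (s.reg r * m)
      fun l s' => I (s.reg r) l s' ∧ s'.time ≤ s.time + (1 + s.reg r * (τ + 1)) := by
  rw [Prog.exec]
  suffices ∀ j ≤ s.reg r, Interaction.DrawSpec c
      (Nat.rec (.ret (s.tick 1)) (fun _ t => t.bind fun s' => P.exec n (s'.tick 1)) j :
        Interaction n State) (j * m)
      fun l s' => I j l s' ∧ s'.time ≤ s.time + (1 + j * (τ + 1)) from this _ le_rfl
  intro j
  induction j with
  | zero =>
    intro _
    rw [zero_mul]
    exact .ret ⟨htick _ _ _ _ h0, by simp [State.tick]⟩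
  | succ j ih =>
    intro hj
    rw [Nat.succ_mul]
    refine (ih (by omega)).bind fun l s' hs' =>
      (hstep j hj l _ (htick _ _ _ 1 hs'.1)).mono fun l' s'' hs'' => ⟨hs''.1, ?_⟩
    calc s''.time ≤ s'.time + 1 + τ := hs''.2
      _ ≤ s.time + (1 + j * (τ + 1)) + 1 + τ := by gcongr; exact hs'.2
      _ = s.time + (1 + (j + 1) * (τ + 1)) := by ring

theorem exec_loop (I : ℕ → State → Prop) (htick : ∀ j s t, I j s → I j (s.tick t)) (h0 : I 0 s)
    (hstep : ∀ j < s.reg r, ∀ s', I j s' →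
      ∃ s'', P.exec n s' = .ret s'' ∧ I (j + 1) s'' ∧ s''.time ≤ s'.time + τ) :
    ∃ s', (Prog.loop r P).exec n s = .ret s' ∧ I (s.reg r) s' ∧
      s'.time ≤ s.time + (1 + s.reg r * (τ + 1)) := by
  have h := drawSpec_loop (c := fun _ => false) (P := P) (m := 0) (fun j _ => I j)
    (fun j _ => htick j) h0 fun j hj _ s' hs' => Interaction.drawSpec_zero_iff.2 (hstep j hj s' hs')
  rw [mul_zero] at h
  exact Interaction.drawSpec_zero_iff.1 h

/-- Nested loops around `P` whose round counts are in the registers `rs`, outermost first. -/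
def nest (rs : List ℕ) (P : Prog) : Prog := rs.foldr Prog.loop P

/-- The running time of nested loops with round counts `v r` and a body that takes time `t`. It is
defined over any semiring, so that it also gives the running time as a polynomial. -/
def nestCost {R : Type*} [Semiring R] (v : ℕ → R) (rs : List ℕ) (t : R) : R :=
  rs.foldr (fun r t => 1 + v r * (t + 1)) t

theorem map_nestCost {R S : Type*} [Semiring R] [Semiring S] (f : R →+* S) (v : ℕ → R)
    (rs : List ℕ) (t : R) : f (nestCost v rs t) = nestCost (fun r => f (v r)) rs (f t) := by
  induction rs with
  | nil => rfl
  | cons r rs ih => simpa [nestCost] using congrArg (fun y => 1 + f (v r) * (y + 1)) ih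

theorem drawSpec_nest {rs : List ℕ} {v : ℕ → ℕ} (I : List (Cube n) → State → Prop)
    (htick : ∀ l s t, I l s → I l (s.tick t)) (hreg : ∀ l s, I l s → ∀ r ∈ rs, s.reg r = v r)
    (hP : ∀ l s, I l s → (P.exec n s).DrawSpec c m
      fun l' s' => I (l ++ l') s' ∧ s'.time ≤ s.time + τ)
    (l : List (Cube n)) (s : State) (hs : I l s) :
    ((nest rs P).exec n s).DrawSpec c ((rs.map v).prod * m)
      fun l' s' => I (l ++ l') s' ∧ s'.time ≤ s.time + nestCost v rs τ := by
  induction rs generalizing l s with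
  | nil => simpa [nest, nestCost] using hP l s hs
  | cons r rs ih =>
    have h := drawSpec_loop (c := c) (r := r) (P := nest rs P) (s := s) (fun _ l' => I (l ++ l'))
      (fun _ l' => htick (l ++ l')) (by rwa [List.append_nil]) fun _ _ l' s' hI => by
        simpa only [List.append_assoc] using
          ih (fun l s h r hr => hreg l s h r (List.mem_cons_of_mem _ hr)) (l ++ l') s' hI
    rw [hreg l s hs r List.mem_cons_self] at h
    simpa [nest, nestCost, mul_assoc] using h

end Loops

section Elimination

/-- The literals that are satisfied by all positive examples in `l`; the elimination algorithm
returns their conjunction. -/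
def consistentLits {n : ℕ} (c : BoolFun n) (l : List (Cube n)) : Set (Fin n × Bool) :=
  {p | ∀ x ∈ l, c x = true → x p.1 = p.2}

theorem consistentLits_append_singleton {n : ℕ} (c : BoolFun n) (l : List (Cube n)) (x : Cube n) :
    consistentLits c (l ++ [x]) = {p ∈ consistentLits c l | c x = true → x p.1 = p.2} := by
  ext p
  simp [consistentLits, or_imp, forall_and]

/-- The literals that the heap marks as present, in the encoding of `State.hypothesis`. -/
def State.Represents {n : ℕ} (s : State) (H : Set (Fin n × Bool)) : Prop :=
  ∀ (i : Fin n) (b : Bool), s.heap (2 * (i : ℕ) + b.toNat) ≠ 0 ↔ (i, b) ∈ H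

namespace State

variable {n : ℕ} {s : State} {H : Set (Fin n × Bool)}

theorem Represents.hypothesis_eq (h : s.Represents H) : s.hypothesis n = conj H :=
  congrArg conj (Set.ext fun p => h p.1 p.2)

theorem Represents.setHeap_zero (h : s.Represents H) (i : Fin n) (b : Bool) :
    (s.setHeap (2 * (i : ℕ) + b.toNat) 0).Represents (H \ {(i, b)}) := by
  intro i' b'
  rw [setHeap]
  by_cases heq : (i', b') = (i, b)
  · obtain ⟨rfl, rfl⟩ := Prod.mk.inj heq
    simp
  · have hne : 2 * (i' : ℕ) + b'.toNat ≠ 2 * (i : ℕ) + b.toNat := by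
      contrapose! heq
      rw [Prod.mk.injEq, Fin.ext_iff]
      cases b <;> cases b' <;> simp at heq ⊢ <;> omega
    simp [Function.update_of_ne hne, heq, ← h i' b']

theorem Represents.writePoint (h : s.Represents H) {a : ℕ} (ha : n + n ≤ a) (x : Cube n) :
    (s.writePoint a x).Represents H := by
  intro i b
  have hlt : ¬ (a ≤ 2 * (i : ℕ) + b.toNat ∧ 2 * (i : ℕ) + b.toNat < a + n) := by
    have := b.toNat_le
    omega
  simp only [State.writePoint, dif_neg hlt, h i b]

theorem heap_writePoint_add (a : ℕ) (x : Cube n) (i : Fin n) :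
    (s.writePoint a x).heap (a + i) = (x i).toNat := by
  simp [State.writePoint]

end State

/-- The contents of the registers `0, …, 5` of the elimination algorithm: the inputs `n`,
`A = ⌈1/ε⌉` and `B = ⌈1/δ⌉`, the constant `K`, the address `n + n` of the current example, and `1`.
They are defined over any semiring, so that they also give the round counts as polynomials. -/
def fixedReg {R : Type*} [Semiring R] (n A B K : R) : ℕ → R
  | 0 => n
  | 1 => A
  | 2 => B
  | 3 => K
  | 4 => n + n
  | _ => 1

theorem map_fixedReg {R S : Type*} [Semiring R] [Semiring S] (f : R →+* S) (n A B K : R) (r : ℕ) :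
    f (fixedReg n A B K r) = fixedReg (f n) (f A) (f B) (f K) r := by
  unfold fixedReg
  split <;> simp

/-- Marks all literals as present and sets up the registers. -/
def setupProg (K : ℕ) : Prog :=
  .seq (.const 3 K) <| .seq (.const 5 1) <| .seq (.add 4 0 0) <| .seq (.const 6 0) <|
    .loop 4 (.seq (.store 6 5) (.add 6 6 5))

/-- Deletes the literal of the current variable that the current example violates, and moves on to
the next variable. Register `6` holds the address of the literals of the current variable and
register `8` that of its value in the example. -/
def deleteProg : Prog :=
  .seq (.load 9 8) <| .seq (.sub 10 5 9) <| .seq (.add 10 10 6) <| .seq (.const 11 0) <|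
    .seq (.store 10 11) <| .seq (.add 6 6 5) <| .seq (.add 6 6 5) (.add 8 8 5)

/-- Deletes all literals that the current example violates. -/
def updateProg : Prog := .seq (.const 6 0) <| .seq (.copy 8 4) (.loop 0 deleteProg)

/-- Draws an example and, if it is positive, deletes the literals that it violates. -/
def exampleProg : Prog := .seq (.ex 4 7) (.ifz 7 (.const 7 0) updateProg)

/-- The registers that count the rounds of the main loops. -/
def loopRegs (a : ℕ) : List ℕ := 3 :: List.replicate a 0 ++ [1, 1, 1, 2]

/-- The elimination algorithm for conjunctions on `K * n ^ a * ⌈1/ε⌉ ^ 3 * ⌈1/δ⌉` examples. -/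
def eliminationProg (K a : ℕ) : Prog := .seq (setupProg K) (nest (loopRegs a) exampleProg)

variable {n : ℕ} (A B K : ℕ)

/-- The state of the elimination algorithm after the examples `l` for the target `c`. -/
structure EliminationState (c : BoolFun n) (l : List (Cube n)) (s : State) : Prop where
  reg : ∀ r < 6, s.reg r = fixedReg n A B K r
  represents : s.Represents (consistentLits c l)

/-- The state of the elimination algorithm when, starting from the literals `H`, the literals of
the first `j` variables that the example `x` violates have been deleted. -/
structure DeletionState (x : Cube n) (H : Set (Fin n × Bool)) (j : ℕ) (s : State) : Prop where
  reg : ∀ r < 6, s.reg r = fixedReg n A B K r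
  reg_six : s.reg 6 = j + j
  reg_eight : s.reg 8 = n + n + j
  example_eq : ∀ i : Fin n, s.heap (n + n + i) = (x i).toNat
  represents : s.Represents {p ∈ H | (p.1 : ℕ) < j → x p.1 = p.2}

variable {A B K}

theorem exec_setupProg (c : BoolFun n) :
    ∃ s, (setupProg K).exec n (State.init n A B) = .ret s ∧ EliminationState A B K c [] s ∧
      s.time ≤ 6 * n + 5 := by
  set s₀ : State := ((((((((State.init n A B).setReg 3 K).tick 1).setReg 5 1).tick 1).setReg 4
    (n + n)).tick 1).setReg 6 0).tick 1 with hs₀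
  have hexec : (setupProg K).exec n (State.init n A B) =
      (Prog.loop 4 (.seq (.store 6 5) (.add 6 6 5))).exec n s₀ := by
    simp [setupProg, Prog.exec, Interaction.bind, hs₀, State.init, State.setReg, State.tick]
  have hreg₀ : ∀ r < 6, s₀.reg r = fixedReg n A B K r := by
    intro r hr
    interval_cases r <;> simp [hs₀, State.setReg, State.tick, State.init, fixedReg]
  obtain ⟨s, hs, ⟨hreg, -, hheap⟩, htime⟩ := exec_loop (n := n) (r := 4) (τ := 2) (s := s₀)
    (P := .seq (.store 6 5) (.add 6 6 5))
    (fun j s => (∀ r < 6, s.reg r = fixedReg n A B K r) ∧ s.reg 6 = j ∧ ∀ i < j, s.heap i ≠ 0)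
    (fun _ _ _ h => h) ⟨hreg₀, by simp [hs₀, State.setReg, State.tick], by simp⟩ (by
      rintro j - s ⟨hreg, h6, hheap⟩
      have h5 : s.reg 5 = 1 := hreg 5 (by omega)
      refine ⟨_, rfl, ⟨fun r hr => ?_, ?_, fun i hi => ?_⟩, by simp [State.tick, State.setReg,
        State.setHeap]⟩
      · simp [State.tick, State.setReg, State.setHeap, Function.update_of_ne hr.ne, hreg r hr]
      · simp [State.tick, State.setReg, State.setHeap, h5, h6]
      · rcases eq_or_ne i j with rfl | hne
        · simp [State.tick, State.setReg, State.setHeap, h5, h6]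
        · simpa [State.tick, State.setReg, State.setHeap, h6, hne] using hheap i (by omega))
  have h4 : s₀.reg 4 = n + n := hreg₀ 4 (by omega)
  rw [h4] at hheap htime
  refine ⟨s, hexec.trans hs, ⟨hreg, fun i b => iff_of_true (hheap _ ?_) (by simp [consistentLits])⟩,
    ?_⟩
  · have := b.toNat_le
    omega
  · simp only [hs₀, State.tick, State.setReg, State.init] at htime
    omega

theorem exec_deleteProg {x : Cube n} {H : Set (Fin n × Bool)} {j : ℕ} {s : State}
    (hs : DeletionState A B K x H j s) (hj : j < n) :
    ∃ s', deleteProg.exec n s = .ret s' ∧ DeletionState A B K x H (j + 1) s' ∧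
      s'.time ≤ s.time + 8 := by
  have h5 : s.reg 5 = 1 := hs.reg 5 (by omega)
  have hx : s.heap (n + n + j) = (x ⟨j, hj⟩).toNat := hs.example_eq ⟨j, hj⟩
  have haddr : 1 - (x ⟨j, hj⟩).toNat + (j + j) = 2 * j + (!x ⟨j, hj⟩).toNat := by
    cases x ⟨j, hj⟩ <;> simp <;> omega
  have hset : {p ∈ H | (p.1 : ℕ) < j + 1 → x p.1 = p.2} =
      {p ∈ H | (p.1 : ℕ) < j → x p.1 = p.2} \ {(⟨j, hj⟩, !x ⟨j, hj⟩)} := by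
    ext ⟨i, b⟩
    by_cases hij : i = ⟨j, hj⟩
    · subst hij
      cases b <;> simp
    · have hne : (i : ℕ) ≠ j := fun h => hij (Fin.ext h)
      have hlt : (i : ℕ) < j + 1 ↔ (i : ℕ) < j := by omega
      simp [hlt, hij, -Order.lt_add_one_iff]
  refine ⟨_, rfl, ⟨fun r hr => ?_, ?_, ?_, fun i => ?_, ?_⟩, ?_⟩
  all_goals
    simp only [State.tick, State.setReg, State.setHeap, Function.update_self, ne_eq,
      Nat.reduceEqDiff, not_false_eq_true, Function.update_of_ne, h5, hs.reg_six, hs.reg_eight, hx,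
      haddr]
  · rw [Function.update_of_ne (by omega), Function.update_of_ne (by omega),
      Function.update_of_ne (by omega), Function.update_of_ne (by omega),
      Function.update_of_ne (by omega), Function.update_of_ne (by omega),
      Function.update_of_ne (by omega), hs.reg r hr]
  · omega
  · omega
  · have := (!x ⟨j, hj⟩).toNat_le
    rw [Function.update_of_ne (by omega), hs.example_eq]
  · rw [hset]
    exact hs.represents.setHeap_zero ⟨j, hj⟩ _
  · omega

theorem exec_updateProg {x : Cube n} {H : Set (Fin n × Bool)} {s : State}
    (hreg : ∀ r < 6, s.reg r = fixedReg n A B K r)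
    (hx : ∀ i : Fin n, s.heap (n + n + i) = (x i).toNat) (hH : s.Represents H) :
    ∃ s', updateProg.exec n s = .ret s' ∧ (∀ r < 6, s'.reg r = fixedReg n A B K r) ∧
      s'.Represents {p ∈ H | x p.1 = p.2} ∧ s'.time ≤ s.time + (9 * n + 3) := by
  have h4 : s.reg 4 = n + n := hreg 4 (by omega)
  set s₀ : State := (((s.setReg 6 0).tick 1).setReg 8 (n + n)).tick 1 with hs₀
  have hexec : updateProg.exec n s = (Prog.loop 0 deleteProg).exec n s₀ := by
    simp [updateProg, Prog.exec, Interaction.bind, hs₀, State.setReg, State.tick, h4]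
  have hreg₀ : ∀ r < 6, s₀.reg r = fixedReg n A B K r := fun r hr => by
    simp only [hs₀, State.tick, State.setReg]
    rw [Function.update_of_ne (by omega), Function.update_of_ne (by omega), hreg r hr]
  have hH₀ : s₀.Represents H := hH
  have hstart : DeletionState A B K x H 0 s₀ :=
    ⟨hreg₀, by simp [hs₀, State.tick, State.setReg], by simp [hs₀, State.tick, State.setReg], hx,
      by simpa using hH₀⟩
  have h0 : s₀.reg 0 = n := hreg₀ 0 (by omega)
  obtain ⟨s', hs', hdel, htime⟩ := exec_loop (r := 0) (DeletionState A B K x H)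
    (fun _ _ _ h => ⟨h.reg, h.reg_six, h.reg_eight, h.example_eq, h.represents⟩) hstart
    fun j hj s' hs' => exec_deleteProg hs' (h0 ▸ hj)
  rw [h0] at hdel htime
  refine ⟨s', hexec.trans hs', hdel.reg, by simpa using hdel.represents, htime.trans ?_⟩
  simp only [hs₀, State.tick, State.setReg]
  omega

theorem drawSpec_exampleProg {c : BoolFun n} {l : List (Cube n)} {s : State}
    (hs : EliminationState A B K c l s) :
    (exampleProg.exec n s).DrawSpec c 1
      fun l' s' => EliminationState A B K c (l ++ l') s' ∧ s'.time ≤ s.time + (10 * n + 5) := by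
  have h4 : s.reg 4 = n + n := hs.reg 4 (by omega)
  refine .draw fun x => Interaction.drawSpec_zero_iff.2 ?_
  rw [h4]
  set s₁ : State := ((s.writePoint (n + n) x).setReg 7 (c x).toNat).tick (n + 1) with hs₁
  have hreg₁ : ∀ r < 6, s₁.reg r = fixedReg n A B K r := fun r hr => by
    rw [← hs.reg r hr]
    exact Function.update_of_ne (by omega) _ _
  have hH₁ : s₁.Represents (consistentLits c l) := hs.represents.writePoint le_rfl x
  have h7 : s₁.reg 7 = (c x).toNat := by
    simp only [hs₁, State.tick, State.setReg, Function.update_self]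
  have hexec : (Prog.ifz 7 (.const 7 0) updateProg).exec n s₁ =
      if (c x).toNat = 0 then .ret (((s₁.tick 1).setReg 7 0).tick 1)
        else updateProg.exec n (s₁.tick 1) := by
    rw [Prog.exec, h7, Prog.exec]
  rcases Bool.eq_false_or_eq_true (c x) with hc | hc
  · obtain ⟨s', hs', hreg, hH, htime⟩ := exec_updateProg (s := s₁.tick 1) hreg₁
      (State.heap_writePoint_add (n + n) x) hH₁
    refine ⟨s', hexec.trans (by rw [hc]; exact hs'),
      ⟨hreg, by simpa [consistentLits_append_singleton, hc] using hH⟩, htime.trans ?_⟩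
    simp only [hs₁, State.tick, State.setReg, State.writePoint]
    omega
  · have hlits : consistentLits c (l ++ [x]) = consistentLits c l := by
      simp [consistentLits_append_singleton, hc]
    refine ⟨_, hexec.trans (by rw [hc]; rfl), ⟨fun r hr => ?_, by rw [hlits]; exact hH₁⟩, ?_⟩
    · rw [← hreg₁ r hr]
      exact Function.update_of_ne (by omega) _ _
    · simp only [hs₁, State.tick, State.setReg, State.writePoint]
      omega

end Elimination

section Complexity

theorem lt_six_of_mem_loopRegs {a r : ℕ} (hr : r ∈ loopRegs a) : r < 6 := by
  simp only [loopRegs, List.mem_append, List.mem_cons, List.mem_replicate] at hr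
  grind

theorem prod_map_loopRegs {R : Type*} [CommSemiring R] (n A B K : R) (a : ℕ) :
    ((loopRegs a).map (fixedReg n A B K)).prod = K * n ^ a * A ^ 3 * B := by
  simp [loopRegs, fixedReg]
  ring

/-- The number of examples of `eliminationProg K a` as a polynomial in `n`, `⌈1/ε⌉` and `⌈1/δ⌉`. -/
noncomputable def examplePoly (K a : ℕ) : MvPolynomial (Fin 3) ℕ :=
  .C K * .X 0 ^ a * .X 1 ^ 3 * .X 2

/-- A bound for the running time of `eliminationProg K a` as a polynomial in `n`, `⌈1/ε⌉` and
`⌈1/δ⌉`. -/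
noncomputable def timePoly (K a : ℕ) : MvPolynomial (Fin 3) ℕ :=
  6 * .X 0 + 5 + nestCost (fixedReg (.X 0) (.X 1) (.X 2) (.C K)) (loopRegs a) (10 * .X 0 + 5)

variable (K a n : ℕ) (ε δ : ℝ)

theorem polyBound_examplePoly :
    polyBound (examplePoly K a) n ε δ = K * n ^ a * ⌈1 / ε⌉₊ ^ 3 * ⌈1 / δ⌉₊ := by
  simp [polyBound, examplePoly]

theorem polyBound_timePoly :
    polyBound (timePoly K a) n ε δ =
      6 * n + 5 + nestCost (fixedReg n ⌈1 / ε⌉₊ ⌈1 / δ⌉₊ K) (loopRegs a) (10 * n + 5) := by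
  simp [polyBound, timePoly, map_nestCost, map_fixedReg]

theorem drawSpec_eliminationProg (c : BoolFun n) :
    ((eliminationProg K a).run n ε δ).DrawSpec c (polyBound (examplePoly K a) n ε δ)
      fun l s => s.hypothesis n = conj (consistentLits c l) ∧
        s.time ≤ polyBound (timePoly K a) n ε δ := by
  obtain ⟨s₀, hexec, hs₀, htime₀⟩ :=
    exec_setupProg (n := n) (A := ⌈1 / ε⌉₊) (B := ⌈1 / δ⌉₊) (K := K) c
  have hloops := drawSpec_nest (rs := loopRegs a) (EliminationState ⌈1 / ε⌉₊ ⌈1 / δ⌉₊ K c)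
    (fun _ _ _ h => ⟨h.reg, h.represents⟩)
    (fun _ _ h r hr => h.reg r (lt_six_of_mem_loopRegs hr))
    (fun _ _ => drawSpec_exampleProg) [] s₀ hs₀
  rw [prod_map_loopRegs, mul_one] at hloops
  rw [Prog.run, eliminationProg, Prog.exec, hexec, polyBound_examplePoly, polyBound_timePoly]
  exact hloops.mono fun l s hs => ⟨hs.1.represents.hypothesis_eq, hs.2.trans (by gcongr)⟩

/-- The elimination algorithm as a learner. -/
noncomputable def eliminationLearner : Learner n :=
  ((eliminationProg K a).run n ε δ).bind fun s => .ret (s.hypothesis n)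

theorem drawSpec_eliminationLearner (c : BoolFun n) :
    (eliminationLearner K a n ε δ).DrawSpec c (polyBound (examplePoly K a) n ε δ)
      fun l h => h = conj (consistentLits c l) :=
  (drawSpec_eliminationProg K a n ε δ c).bind fun l _ hs => .ret (by simpa using hs.1)

end Complexity

/-! ### The success probability of the elimination algorithm -/

section UniformDistribution

theorem sum_pow_card_filter_ne {ι K : Type*} [Fintype ι] [DecidableEq ι] [Field K] [NeZero (2 : K)]
    (F : Finset ι) (y : ι → Bool) (t : K) :
    ∑ x : ι → Bool, t ^ {i ∈ F | x i ≠ y i}.card = ((1 + t) / 2) ^ F.card * 2 ^ Fintype.card ι := by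
  have hprod (x : ι → Bool) :
      t ^ {i ∈ F | x i ≠ y i}.card = ∏ i, if i ∈ F ∧ x i ≠ y i then t else 1 := by
    rw [← Finset.prod_filter, Finset.prod_const]
    congr 2
    ext i
    simp
  have hsum (i : ι) :
      ∑ b : Bool, (if i ∈ F ∧ b ≠ y i then t else 1) = (if i ∈ F then (1 + t) / 2 else 1) * 2 := by
    by_cases hi : i ∈ F <;> cases y i <;> simp [hi, add_comm, one_add_one_eq_two, two_ne_zero]
  simp_rw [hprod]
  rw [← Fintype.prod_sum fun (i : ι) (b : Bool) => if i ∈ F ∧ b ≠ y i then t else 1]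
  simp_rw [hsum]
  rw [Finset.prod_mul_distrib, Finset.prod_ite_mem, Finset.univ_inter, Finset.prod_const,
    Finset.prod_const, Finset.card_univ]

variable {n : ℕ}

theorem uniform_toOuterMeasure_le {S : Set (Cube n)} {f : Cube n → ℝ} (h0 : ∀ x, 0 ≤ f x)
    (h1 : ∀ x ∈ S, 1 ≤ f x) :
    (uniform n).toOuterMeasure S ≤ ENNReal.ofReal ((∑ x, f x) / 2 ^ n) := by
  classical
  have hcard : ((Fintype.card S : ℕ) : ℝ) ≤ ∑ x, f x := by
    rw [← Set.toFinset_card, Finset.cast_card]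
    exact (Finset.sum_le_sum fun x hx => h1 x (Set.mem_toFinset.1 hx)).trans
      (Finset.sum_le_univ_sum_of_nonneg h0)
  rw [uniform, PMF.toOuterMeasure_uniformOfFintype_apply, ENNReal.ofReal_div_of_pos (by positivity),
    ENNReal.ofReal_pow zero_le_two, ENNReal.ofReal_ofNat, ← ENNReal.ofReal_natCast]
  simp only [Fintype.card_fun, Fintype.card_bool, Fintype.card_fin, Nat.cast_pow, Nat.cast_ofNat]
  gcongr

theorem uniform_card_filter_ne_le (F : Finset (Fin n)) (y : Cube n) (r : ℝ) :
    (uniform n).toOuterMeasure {x | ({i ∈ F | x i ≠ y i}.card : ℝ) ≤ r} ≤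
      ENNReal.ofReal (2 ^ r * (3 / 4) ^ F.card) := by
  have hmarkov (x : Cube n) (hx : ({i ∈ F | x i ≠ y i}.card : ℝ) ≤ r) :
      1 ≤ (2 : ℝ) ^ r * (1 / 2) ^ {i ∈ F | x i ≠ y i}.card := by
    rw [one_div, inv_pow, ← div_eq_mul_inv, one_le_div (by positivity), ← Real.rpow_natCast]
    exact Real.rpow_le_rpow_of_exponent_le one_le_two hx
  refine (uniform_toOuterMeasure_le (fun x => by positivity) hmarkov).trans_eq ?_
  rw [← Finset.mul_sum, sum_pow_card_filter_ne, Fintype.card_fin, ← mul_assoc,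
    mul_div_cancel_right₀ _ (by positivity)]
  norm_num

theorem uniform_compl_forall_eq_le (F : Finset (Fin n)) (y : Cube n) :
    (uniform n).toOuterMeasure {x | ∀ i ∈ F, x i = y i}ᶜ ≤
      ENNReal.ofReal (1 - (1 / 2) ^ F.card) := by
  have hdiffer (x : Cube n) (hx : x ∈ {x | ∀ i ∈ F, x i = y i}ᶜ) :
      {i ∈ F | x i ≠ y i}.card ≠ 0 := by
    simpa [Finset.filter_eq_empty_iff] using hx
  refine (uniform_toOuterMeasure_le (f := fun x => 1 - 0 ^ {i ∈ F | x i ≠ y i}.card)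
    (fun x => sub_nonneg.2 (pow_le_one₀ le_rfl zero_le_one))
    fun x hx => by rw [zero_pow (hdiffer x hx), sub_zero]).trans_eq ?_
  rw [Finset.sum_sub_distrib, sum_pow_card_filter_ne, sub_div, Fintype.card_fin,
    mul_div_cancel_right₀ _ (by positivity)]
  simp

end UniformDistribution

section UpperBound

variable {n : ℕ} {L H : Set (Fin n × Bool)} {x y : Cube n}

theorem conj_eq_true_iff : conj L x = true ↔ ∀ p ∈ L, x p.1 = p.2 := by
  simp [conj]

theorem conj_eq_true_of_subset (hLH : L ⊆ H) (h : conj H x = true) : conj L x = true :=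
  conj_eq_true_iff.2 fun p hp => conj_eq_true_iff.1 h p (hLH hp)

theorem subset_consistentLits (L : Set (Fin n × Bool)) (l : List (Cube n)) :
    L ⊆ consistentLits (conj L) l :=
  fun p hp _ _ hx => conj_eq_true_iff.1 hx p hp

/-- The variables that occur in a set of literals. -/
noncomputable def usedVars (L : Set (Fin n × Bool)) : Finset (Fin n) :=
  (L.toFinite.image Prod.fst).toFinset

theorem conj_eq_true_iff_forall_usedVars (hy : conj L y = true) :
    conj L x = true ↔ ∀ i ∈ usedVars L, x i = y i := by
  rw [conj_eq_true_iff] at hy ⊢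
  simp only [usedVars, Set.Finite.mem_toFinset, Set.forall_mem_image]
  exact forall₂_congr fun p hp => by rw [hy p hp]

theorem exists_conj_eq_true_ne (hy : conj L y = true) {p : Fin n × Bool} (hp : p ∉ L) :
    ∃ z, conj L z = true ∧ z p.1 ≠ p.2 := by
  by_cases hyp : y p.1 = p.2
  · refine ⟨Function.update y p.1 (!p.2), conj_eq_true_iff.2 fun q hq => ?_, by simp⟩
    have hyq : y q.1 = q.2 := conj_eq_true_iff.1 hy q hq
    have hne : q.1 ≠ p.1 := fun h => hp (Prod.ext h (by rw [← hyq, h, hyp]) ▸ hq)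
    rw [Function.update_of_ne hne, hyq]
  · exact ⟨y, hy, hyp⟩

theorem robustRisk_self (D : PMF (Cube n)) (r : ℝ) (c : BoolFun n) : robustRisk D r c c = 0 := by
  simp [robustRisk]

theorem robustRisk_conj_le_of_subset (D : PMF (Cube n)) (r : ℝ) (hLH : L ⊆ H) :
    robustRisk D r (conj H) (conj L) ≤
      D.toOuterMeasure {x | ∃ z, (hammingDist x z : ℝ) ≤ r ∧ conj L z = true} := by
  refine MeasureTheory.measure_mono fun x ⟨z, hz, hne⟩ => ⟨z, hz, ?_⟩
  by_contra hL
  have hH : ¬ conj H z = true := mt (conj_eq_true_of_subset hLH) hL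
  rw [Bool.not_eq_true] at hL hH
  exact hne (hL.trans hH.symm)

theorem satisfiable_and_lt_of_lt_robustRisk {r ε : ℝ} (hLH : L ⊆ H)
    (h : ENNReal.ofReal ε < robustRisk (uniform n) r (conj H) (conj L)) :
    (∃ y, conj L y = true) ∧ ε < 2 ^ r * (3 / 4) ^ (usedVars L).card := by
  have hlt := h.trans_le (robustRisk_conj_le_of_subset (uniform n) r hLH)
  have hsat : ∃ y, conj L y = true := by
    by_contra hunsat
    have hempty : {x : Cube n | ∃ z, (hammingDist x z : ℝ) ≤ r ∧ conj L z = true} = ∅ :=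
      Set.eq_empty_of_forall_notMem fun x ⟨z, _, hz⟩ => hunsat ⟨z, hz⟩
    simp [hempty] at hlt
  obtain ⟨y, hy⟩ := hsat
  refine ⟨⟨y, hy⟩, lt_of_not_ge fun hle => hlt.not_ge ?_⟩
  have hnear : {x : Cube n | ∃ z, (hammingDist x z : ℝ) ≤ r ∧ conj L z = true} ⊆
      {x | ({i ∈ usedVars L | x i ≠ y i}.card : ℝ) ≤ r} := by
    rintro x ⟨z, hz, hLz⟩
    refine (Nat.cast_le.2 (Finset.card_le_card fun i hi => ?_)).trans hz
    rw [Finset.mem_filter] at hi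
    simpa [(conj_eq_true_iff_forall_usedVars hy).1 hLz i hi.1] using hi.2
  exact (MeasureTheory.measure_mono hnear).trans
    ((uniform_card_filter_ne_le (usedVars L) y r).trans (ENNReal.ofReal_le_ofReal hle))

theorem samples_mem_consistentLits_le (hy : conj L y = true) {p : Fin n × Bool} (hp : p ∉ L)
    (m : ℕ) :
    (samples (uniform n) m).toOuterMeasure {l | p ∈ consistentLits (conj L) l} ≤
      ENNReal.ofReal ((1 - (1 / 2) ^ ((usedVars L).card + 1)) ^ m) := by
  obtain ⟨z, hz, hzp⟩ := exists_conj_eq_true_ne hy hp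
  set F := insert p.1 (usedVars L)
  have hF : (1 / 2 : ℝ) ^ ((usedVars L).card + 1) ≤ (1 / 2) ^ F.card :=
    pow_le_pow_of_le_one (by norm_num) (by norm_num) (Finset.card_insert_le _ _)
  have hle_one : (1 / 2 : ℝ) ^ ((usedVars L).card + 1) ≤ 1 :=
    pow_le_one₀ (by norm_num) (by norm_num)
  have hviolates (x : Cube n) (hx : ∀ i ∈ F, x i = z i) : conj L x = true ∧ x p.1 ≠ p.2 :=
    ⟨(conj_eq_true_iff_forall_usedVars hz).2 fun i hi => hx i (Finset.mem_insert_of_mem hi),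
      by rwa [hx _ (Finset.mem_insert_self _ _)]⟩
  calc (samples (uniform n) m).toOuterMeasure {l | p ∈ consistentLits (conj L) l}
      ≤ (samples (uniform n) m).toOuterMeasure
          {l | ∀ x ∈ l, x ∈ {x : Cube n | ∀ i ∈ F, x i = z i}ᶜ} :=
        MeasureTheory.measure_mono fun l hl x hx hxF =>
          (hviolates x hxF).2 (hl x hx (hviolates x hxF).1)
    _ = (uniform n).toOuterMeasure {x | ∀ i ∈ F, x i = z i}ᶜ ^ m := samples_forall_mem _ _ _
    _ ≤ ENNReal.ofReal (1 - (1 / 2) ^ F.card) ^ m := by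
        gcongr
        exact uniform_compl_forall_eq_le F z
    _ ≤ ENNReal.ofReal (1 - (1 / 2) ^ ((usedVars L).card + 1)) ^ m := by gcongr
    _ = _ := (ENNReal.ofReal_pow (sub_nonneg.2 hle_one) m).symm

theorem samples_consistentLits_ne_le (hy : conj L y = true) (m : ℕ) :
    (samples (uniform n) m).toOuterMeasure {l | consistentLits (conj L) l ≠ L} ≤
      ENNReal.ofReal (2 * n * (1 - (1 / 2) ^ ((usedVars L).card + 1)) ^ m) := by
  classical
  set q : ℝ := (1 - (1 / 2) ^ ((usedVars L).card + 1)) ^ m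
  have hsub : {l | consistentLits (conj L) l ≠ L} ⊆
      ⋃ p ∈ Finset.univ.filter (· ∉ L), {l | p ∈ consistentLits (conj L) l} := by
    intro l hl
    obtain ⟨p, hp, hpL⟩ := Set.not_subset.1 fun h => hl (h.antisymm (subset_consistentLits L l))
    exact Set.mem_biUnion (x := p) (by simpa using hpL) hp
  calc (samples (uniform n) m).toOuterMeasure {l | consistentLits (conj L) l ≠ L}
      ≤ ∑ p ∈ Finset.univ.filter (· ∉ L),
          (samples (uniform n) m).toOuterMeasure {l | p ∈ consistentLits (conj L) l} :=
        (MeasureTheory.measure_mono hsub).trans (MeasureTheory.measure_biUnion_finset_le _ _)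
    _ ≤ ∑ _p ∈ Finset.univ.filter (· ∉ L), ENNReal.ofReal q :=
        Finset.sum_le_sum fun _ hp =>
          samples_mem_consistentLits_le hy (Finset.mem_filter.1 hp).2 m
    _ ≤ ∑ _p : Fin n × Bool, ENNReal.ofReal q :=
        Finset.sum_le_sum_of_subset (Finset.filter_subset _ _)
    _ = ENNReal.ofReal (2 * n * q) := by
        rw [Finset.sum_const, nsmul_eq_mul, ← ENNReal.ofReal_natCast,
          ← ENNReal.ofReal_mul (by positivity)]
        simp [mul_comm]

theorem one_sub_pow_mul_le_one {p : ℝ} (h0 : 0 ≤ p) (h1 : p ≤ 1) (m : ℕ) :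
    (1 - p) ^ m * (m * p) ≤ 1 := by
  have hbernoulli : 1 + m * p ≤ (1 + p) ^ m := one_add_mul_le_pow (by linarith) m
  calc (1 - p) ^ m * (m * p) ≤ (1 - p) ^ m * (1 + p) ^ m :=
        mul_le_mul_of_nonneg_left (by linarith) (pow_nonneg (sub_nonneg.2 h1) m)
    _ = (1 - p ^ 2) ^ m := by rw [← mul_pow]; ring
    _ ≤ 1 := pow_le_one₀ (by nlinarith) (by nlinarith)

theorem mul_one_sub_pow_le {a p δ : ℝ} {m : ℕ} (h0 : 0 ≤ p) (h1 : p ≤ 1) (hδ : 0 ≤ δ)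
    (h : a ≤ δ * (m * p)) : a * (1 - p) ^ m ≤ δ := by
  calc a * (1 - p) ^ m ≤ δ * (m * p) * (1 - p) ^ m :=
        mul_le_mul_of_nonneg_right h (pow_nonneg (sub_nonneg.2 h1) m)
    _ = δ * ((1 - p) ^ m * (m * p)) := by ring
    _ ≤ δ := mul_le_of_le_one_right hδ (one_sub_pow_mul_le_one h0 h1 m)

theorem two_pow_le_of_lt_mul_pow {R ε : ℝ} (hε : 0 < ε) {k : ℕ} (h : ε < R * (3 / 4) ^ k) :
    2 ^ k ≤ (R / ε) ^ 3 := by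
  have h43 : (4 / 3 : ℝ) ^ k ≤ R / ε := by
    rw [le_div_iff₀ hε]
    calc (4 / 3) ^ k * ε ≤ (4 / 3) ^ k * (R * (3 / 4) ^ k) := by gcongr
      _ = R * (4 / 3 * (3 / 4)) ^ k := by rw [mul_pow]; ring
      _ = R := by norm_num
  calc (2 : ℝ) ^ k ≤ ((4 / 3) ^ 3) ^ k := by gcongr; norm_num
    _ = ((4 / 3) ^ k) ^ 3 := pow_right_comm _ _ _
    _ ≤ (R / ε) ^ 3 := by gcongr

theorem le_samples_robustRisk_consistentLits_le (L : Set (Fin n × Bool)) {r ε δ : ℝ} (hε : 0 < ε)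
    (hδ : 0 < δ) {m : ℕ} (hm : 4 * n * (2 ^ r / ε) ^ 3 / δ ≤ m) :
    ENNReal.ofReal (1 - δ) ≤ (samples (uniform n) m).toOuterMeasure
      {l | robustRisk (uniform n) r (conj (consistentLits (conj L) l)) (conj L) ≤
        ENNReal.ofReal ε} := by
  refine ofReal_one_sub_le_toOuterMeasure hδ.le ?_
  by_cases hbad : ∃ H, L ⊆ H ∧ ENNReal.ofReal ε < robustRisk (uniform n) r (conj H) (conj L)
  · obtain ⟨H, hLH, hH⟩ := hbad
    obtain ⟨⟨y, hy⟩, hshort⟩ := satisfiable_and_lt_of_lt_robustRisk hLH hH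
    have hsubset : {l | robustRisk (uniform n) r (conj (consistentLits (conj L) l)) (conj L) ≤
        ENNReal.ofReal ε}ᶜ ⊆ {l | consistentLits (conj L) l ≠ L} := by
      intro l hl hL
      simp [hL, robustRisk_self] at hl
    refine (MeasureTheory.measure_mono hsubset).trans ((samples_consistentLits_ne_le hy m).trans
      (ENNReal.ofReal_le_ofReal (mul_one_sub_pow_le (by positivity)
        (pow_le_one₀ (by norm_num) (by norm_num)) hδ.le ?_)))
    rw [div_le_iff₀' hδ] at hm
    calc (2 * n : ℝ) = 4 * n * 2 ^ (usedVars L).card * (1 / 2) ^ ((usedVars L).card + 1) := by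
          rw [pow_succ, mul_assoc (4 * n : ℝ), ← mul_assoc (2 ^ _ : ℝ), ← mul_pow]
          norm_num
          ring
      _ ≤ 4 * n * (2 ^ r / ε) ^ 3 * (1 / 2) ^ ((usedVars L).card + 1) := by
          gcongr
          exact two_pow_le_of_lt_mul_pow hε hshort
      _ ≤ δ * m * (1 / 2) ^ ((usedVars L).card + 1) := by
          gcongr
      _ = _ := mul_assoc _ _ _
  · have hempty : {l | robustRisk (uniform n) r (conj (consistentLits (conj L) l)) (conj L) ≤
        ENNReal.ofReal ε}ᶜ = ∅ :=
      Set.compl_empty_iff.2 <| Set.eq_univ_of_forall fun l =>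
        not_lt.1 fun h => hbad ⟨_, subset_consistentLits L l, h⟩
    simp [hempty]

theorem exists_two_rpow_le_of_isBigO_log {ρ : ℕ → ℝ} (hρ : ρ =O[atTop] fun n : ℕ => Real.log n) :
    ∃ K a : ℕ, ∀ n : ℕ, n ≠ 0 → (2 : ℝ) ^ ρ n ≤ K * (n : ℝ) ^ a := by
  obtain ⟨C, -, hbound⟩ := bound_of_isBigO_nat_atTop hρ
  refine ⟨⌈(2 : ℝ) ^ ρ 1⌉₊ + 1, ⌈Real.log 2 * C⌉₊, fun n hn => ?_⟩
  rcases (Nat.one_le_iff_ne_zero.2 hn).eq_or_lt with rfl | hn1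
  · push_cast
    rw [one_pow, mul_one]
    exact (Nat.le_ceil _).trans (le_add_of_nonneg_right zero_le_one)
  · have hlog : 0 < Real.log n := Real.log_pos (by exact_mod_cast hn1)
    have hρn : ρ n ≤ C * Real.log n := by
      simpa [abs_of_pos hlog] using (le_abs_self _).trans (hbound hlog.ne')
    calc (2 : ℝ) ^ ρ n ≤ 2 ^ (C * Real.log n) := by gcongr; norm_num
      _ = (n : ℝ) ^ (Real.log 2 * C) := by
          rw [Real.rpow_def_of_pos two_pos, Real.rpow_def_of_pos (by positivity)]
          ring_nf
      _ ≤ (n : ℝ) ^ (⌈Real.log 2 * C⌉₊ : ℝ) := by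
          gcongr
          · exact_mod_cast hn1.le
          · exact Nat.le_ceil _
      _ = 1 * (n : ℝ) ^ ⌈Real.log 2 * C⌉₊ := by rw [Real.rpow_natCast, one_mul]
      _ ≤ _ := by
          gcongr
          exact_mod_cast Nat.le_add_left 1 _

theorem exists_succeeds_eliminationLearner {ρ : ℕ → ℝ}
    (hρ : ρ =O[atTop] fun n : ℕ => Real.log n) :
    ∃ K a : ℕ, ∀ (n : ℕ) (ε δ : ℝ), 0 < ε → 0 < δ → ∀ c ∈ Conjunctions n,
      Succeeds (uniform n) (ρ n) ε δ c (eliminationLearner K a n ε δ) := by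
  obtain ⟨K, a, hKa⟩ := exists_two_rpow_le_of_isBigO_log hρ
  refine ⟨4 * K ^ 3, 3 * a + 1, ?_⟩
  rintro n ε δ hε hδ _ ⟨L, rfl⟩
  refine (le_samples_robustRisk_consistentLits_le L hε hδ ?_).trans
    ((drawSpec_eliminationLearner _ _ n ε δ (conj L)).le_law (uniform n) fun l h hh hl => hh ▸ hl)
  rw [polyBound_examplePoly]
  push_cast
  rcases eq_or_ne n 0 with rfl | hn
  · simp
  · calc 4 * n * (2 ^ ρ n / ε) ^ 3 / δ = 4 * n * (2 ^ ρ n) ^ 3 * (1 / ε) ^ 3 * (1 / δ) := by ring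
      _ ≤ 4 * n * (K * (n : ℝ) ^ a) ^ 3 * ⌈1 / ε⌉₊ ^ 3 * ⌈1 / δ⌉₊ := by
          gcongr
          exacts [hKa n hn, Nat.le_ceil _, Nat.le_ceil _]
      _ = _ := by ring

variable (lam : ℕ → ℝ) {ρ : ℕ → ℝ}

theorem polyTimeLearnable_conjunctions (hρ : ρ =O[atTop] fun n : ℕ => Real.log n) :
    PolyTimeLearnable uniform Conjunctions lam ρ := by
  obtain ⟨K, a, hsucceeds⟩ := exists_succeeds_eliminationLearner hρ
  refine ⟨eliminationProg K a, timePoly K a, fun n ε δ hε hδ c hc => ?_⟩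
  have hspec := drawSpec_eliminationProg K a n ε δ c
  exact ⟨hspec.always fun _ _ hs => hs.2, hspec.isLocal _ _, hsucceeds n ε δ hε hδ c hc⟩

theorem sampleEfficientlyLearnable_conjunctions (hρ : ρ =O[atTop] fun n : ℕ => Real.log n) :
    SampleEfficientlyLearnable uniform Conjunctions lam ρ := by
  obtain ⟨K, a, hsucceeds⟩ := exists_succeeds_eliminationLearner hρ
  refine ⟨eliminationLearner K a, examplePoly K a, fun n ε δ hε hδ c hc => ?_⟩
  have hspec := drawSpec_eliminationLearner K a n ε δ c
  exact ⟨hspec.examplesAtMost, hspec.queriesAtMost _, hspec.isLocal _ _,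
    hsucceeds n ε δ hε hδ c hc⟩

end UpperBound

/-! ### The lower bound -/

section LowerBound

theorem sum_apply_le_sum_false_add_one {ι : Type*} [Fintype ι] {y : ι → Bool}
    (hy : ∀ s s', y s = true → y s' = true → s = s') {f : ι → Bool → ENNReal}
    (hf : ∀ s b, f s b ≤ 1) : ∑ s, f s (y s) ≤ ∑ s, f s false + 1 := by
  classical
  have hcard : ∑ s, (if y s = true then (1 : ENNReal) else 0) ≤ 1 := by
    rw [Finset.sum_boole]
    exact_mod_cast Finset.card_le_one.2 fun s hs s' hs' =>
      hy s s' (Finset.mem_filter.1 hs).2 (Finset.mem_filter.1 hs').2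
  calc ∑ s, f s (y s) ≤ ∑ s, (f s false + if y s = true then 1 else 0) := by
        refine Finset.sum_le_sum fun s _ => ?_
        cases y s
        · exact le_self_add
        · simpa using le_add_left (hf s true)
    _ ≤ ∑ s, f s false + 1 := by
        rw [Finset.sum_add_distrib]
        gcongr

variable {n : ℕ}

/-- Every oracle answer is `false`, as it would be for the target `false`, except for at most one of
the targets `cs s`; so each oracle call contributes at most `1` to the sum of the differences. -/
theorem sum_law_le {α ι : Type} [Fintype ι] (D : PMF (Cube n)) {cs : ι → BoolFun n}
    (hcs : ∀ x s s', cs s x = true → cs s' x = true → s = s') (E : ι → Set α)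
    {t : Interaction n α} {m q : ℕ} (hm : t.ExamplesAtMost (fun _ => false) m)
    (hq : t.QueriesAtMost (fun _ => false) q) :
    ∑ s, (t.law D (cs s)).toOuterMeasure (E s) ≤
      ∑ s, (t.law D fun _ => false).toOuterMeasure (E s) + (m + q : ℕ) := by
  have hcall (x : Cube n) (k : Bool → Interaction n α) :
      ∑ s, ((k (cs s x)).law D (cs s)).toOuterMeasure (E s) ≤
        ∑ s, ((k false).law D (cs s)).toOuterMeasure (E s) + 1 :=
    sum_apply_le_sum_false_add_one (f := fun s b => ((k b).law D (cs s)).toOuterMeasure (E s))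
      (hcs x) fun s b => toOuterMeasure_le_one _ _
  induction t generalizing m q with
  | ret a => exact le_self_add
  | draw k ih =>
    obtain ⟨m', rfl, hm⟩ := hm
    refine sum_toOuterMeasure_bind_le D _ _ E _ fun x _ => (hcall x (k x)).trans ?_
    rw [Nat.add_right_comm, Nat.cast_succ, ← add_assoc]
    exact add_le_add_left (ih x false (hm x) (hq x)) 1
  | query x k ih =>
    obtain ⟨q', rfl, hq⟩ := hq
    rw [← Nat.add_assoc, Nat.cast_succ, ← add_assoc]
    exact (hcall x k).trans (add_le_add_left (ih false hm hq) 1)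
  | random μ k ih =>
    exact sum_toOuterMeasure_bind_le μ _ _ E _ fun i hi => ih i (hm i hi) (hq i hi)

theorem false_mem_conjunctions (hn : 0 < n) : (fun _ => false) ∈ Conjunctions n := by
  refine ⟨Set.univ, funext fun x => (Bool.eq_false_iff.2 fun h => ?_).symm⟩
  have hliteral (b : Bool) : x ⟨0, hn⟩ = b := conj_eq_true_iff.1 h (⟨0, hn⟩, b) (Set.mem_univ _)
  exact Bool.false_ne_true ((hliteral false).symm.trans (hliteral true))

variable {F : Finset (Fin n)}

/-- The literals whose conjunction accepts exactly the points with restriction `s` to the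
coordinates in `F`. -/
def subcubeLits (s : F → Bool) : Set (Fin n × Bool) :=
  Set.range fun i : F => (↑i, s i)

theorem conj_subcubeLits_eq_true_iff {s : F → Bool} {x : Cube n} :
    conj (subcubeLits s) x = true ↔ F.restrict x = s := by
  rw [conj_eq_true_iff, subcubeLits, Set.forall_mem_range, funext_iff]
  rfl

theorem exists_hammingDist_le_card_conj_subcubeLits (s : F → Bool) (x : Cube n) :
    ∃ z, hammingDist x z ≤ F.card ∧ conj (subcubeLits s) z = true := by
  refine ⟨fun i => if hi : i ∈ F then s ⟨i, hi⟩ else x i, Finset.card_le_card fun i hi => ?_,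
    conj_subcubeLits_eq_true_iff.2 (funext fun i => dif_pos i.2)⟩
  by_contra hiF
  simp [hiF] at hi

theorem one_le_robustRisk_add (D : PMF (Cube n)) {r : ℝ} (h : BoolFun n) {c c' : BoolFun n}
    (hcc' : ∀ x, ∃ z, (hammingDist x z : ℝ) ≤ r ∧ c z ≠ c' z) :
    1 ≤ robustRisk D r h c + robustRisk D r h c' := by
  refine (toOuterMeasure_add_compl D {x | ∃ z, (hammingDist x z : ℝ) ≤ r ∧ c z ≠ h z}).ge.trans
    (add_le_add_right (MeasureTheory.measure_mono fun x hx => ?_) _)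
  obtain ⟨z, hz, hne⟩ := hcc' x
  have hch : c z = h z := not_not.1 fun hc => hx ⟨z, hz, hc⟩
  exact ⟨z, hz, fun hc' => hne (hch.trans hc'.symm)⟩

theorem Succeeds.law_toOuterMeasure_le {D : PMF (Cube n)} {r ε δ : ℝ} {c c' : BoolFun n}
    {A : Learner n} (hA : Succeeds D r ε δ c A) (hε : ε < 1 / 2)
    (hcc' : ∀ x, ∃ z, (hammingDist x z : ℝ) ≤ r ∧ c z ≠ c' z) :
    (A.law D c).toOuterMeasure {h | robustRisk D r h c' ≤ ENNReal.ofReal ε} ≤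
      ENNReal.ofReal δ := by
  refine le_trans (MeasureTheory.measure_mono ?_) (toOuterMeasure_compl_le hA)
  intro h hc' hc
  have hrisk := (one_le_robustRisk_add D h hcc').trans (add_le_add hc hc')
  rw [← two_mul, ← ENNReal.ofReal_ofNat, ← ENNReal.ofReal_mul zero_le_two,
    ENNReal.one_le_ofReal] at hrisk
  linarith

theorem mul_two_pow_card_le_of_succeeds (hn : 0 < n) {D : PMF (Cube n)} {r ε δ : ℝ}
    (hF : (F.card : ℝ) ≤ r) (hε : ε < 1 / 2) (hδ : 0 ≤ δ) {A : Learner n}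
    (hA : ∀ c ∈ Conjunctions n, Succeeds D r ε δ c A) {m q : ℕ}
    (hm : A.ExamplesAtMost (fun _ => false) m) (hq : A.QueriesAtMost (fun _ => false) q) :
    (1 - 2 * δ) * 2 ^ F.card ≤ m + q := by
  have hfail (s : F → Bool) : (A.law D fun _ => false).toOuterMeasure
      {h | robustRisk D r h (conj (subcubeLits s)) ≤ ENNReal.ofReal ε} ≤ ENNReal.ofReal δ := by
    refine (hA _ (false_mem_conjunctions hn)).law_toOuterMeasure_le hε fun x => ?_
    obtain ⟨z, hz, hs⟩ := exists_hammingDist_le_card_conj_subcubeLits s x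
    exact ⟨z, (Nat.cast_le.2 hz).trans hF, by rw [hs]; exact Bool.false_ne_true⟩
  have hunique (x : Cube n) (s s' : F → Bool) (hs : conj (subcubeLits s) x = true)
      (hs' : conj (subcubeLits s') x = true) : s = s' :=
    (conj_subcubeLits_eq_true_iff.1 hs).symm.trans (conj_subcubeLits_eq_true_iff.1 hs')
  let E (s : F → Bool) : Set (BoolFun n) :=
    {h | robustRisk D r h (conj (subcubeLits s)) ≤ ENNReal.ofReal ε}
  have hsum : ∑ _s : F → Bool, ENNReal.ofReal (1 - δ) ≤
      ∑ _s : F → Bool, ENNReal.ofReal δ + (m + q : ℕ) :=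
    calc ∑ _s : F → Bool, ENNReal.ofReal (1 - δ)
        ≤ ∑ s, (A.law D (conj (subcubeLits s))).toOuterMeasure (E s) :=
          Finset.sum_le_sum fun s _ => hA _ ⟨subcubeLits s, rfl⟩
      _ ≤ ∑ s, (A.law D fun _ => false).toOuterMeasure (E s) + (m + q : ℕ) :=
          sum_law_le D hunique E hm hq
      _ ≤ ∑ _s : F → Bool, ENNReal.ofReal δ + (m + q : ℕ) := by
          gcongr with s
          exact hfail s
  simp only [Finset.sum_const, Finset.card_univ, Fintype.card_fun, Fintype.card_bool,
    Fintype.card_coe, ← ENNReal.ofReal_nsmul] at hsum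
  rw [← ENNReal.ofReal_natCast, ← ENNReal.ofReal_add (by positivity) (by positivity),
    ENNReal.ofReal_le_ofReal_iff (by positivity)] at hsum
  simp only [nsmul_eq_mul] at hsum
  push_cast at hsum
  linarith

theorem eventually_mul_pow_lt_two_pow {u : ℕ → ℕ}
    (hu : (fun n : ℕ => Real.log n) =o[atTop] fun n => (u n : ℝ)) (C : ℝ) (k : ℕ) :
    ∀ᶠ n : ℕ in atTop, C * (n : ℝ) ^ k < 2 ^ u n := by
  have hc : 0 < Real.log 2 / (k + 1) := div_pos (Real.log_pos one_lt_two) k.cast_add_one_pos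
  filter_upwards [hu.def hc,
    tendsto_natCast_atTop_atTop.eventually_gt_atTop C, eventually_gt_atTop 0] with n hlog hC hn
  rw [Real.norm_of_nonneg (Real.log_natCast_nonneg n), RCLike.norm_natCast, div_mul_eq_mul_div,
    le_div_iff₀ (by positivity)] at hlog
  calc C * (n : ℝ) ^ k < n * (n : ℝ) ^ k := by gcongr
    _ = (n : ℝ) ^ (k + 1) := (pow_succ' _ _).symm
    _ ≤ 2 ^ u n := by
        rw [← Real.log_le_log_iff (by positivity) (by positivity), Real.log_pow, Real.log_pow]
        push_cast
        linarith

theorem log_isLittleO_min_floor {ρ : ℕ → ℝ} (h0 : ∀ n, 0 ≤ ρ n)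
    (hρ : (fun n : ℕ => Real.log n) =o[atTop] ρ) :
    (fun n : ℕ => Real.log n) =o[atTop] fun n => ((min ⌊ρ n⌋₊ n : ℕ) : ℝ) := by
  have hlog_atTop : Tendsto (fun n : ℕ => Real.log n) atTop atTop :=
    Real.tendsto_log_atTop.comp tendsto_natCast_atTop_atTop
  have hρ_atTop : Tendsto ρ atTop atTop :=
    (hρ.isBigO.trans_tendsto_norm_atTop (tendsto_norm_atTop_atTop.comp hlog_atTop)).congr
      fun n => Real.norm_of_nonneg (h0 n)
  have hfloor : (fun n : ℕ => Real.log n) =o[atTop] fun n => (⌊ρ n⌋₊ : ℝ) :=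
    hρ.trans_isBigO
      ((isEquivalent_nat_floor (R := ℝ)).comp_tendsto hρ_atTop).symm.isBigO
  have hid : (fun n : ℕ => Real.log n) =o[atTop] fun n : ℕ => (n : ℝ) :=
    Real.isLittleO_log_id_atTop.comp_tendsto tendsto_natCast_atTop_atTop
  refine IsLittleO.of_bound fun c hc => ?_
  filter_upwards [hfloor.def hc, hid.def hc] with n h h'
  rcases min_choice ⌊ρ n⌋₊ n with hmin | hmin <;> rw [hmin] <;> assumption

theorem eventually_mul_pow_lt_of_succeeds {ρ : ℕ → ℝ} (h0 : ∀ n, 0 ≤ ρ n)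
    (hρ : (fun n : ℕ => Real.log n) =o[atTop] ρ) {ε δ : ℝ} (hε : ε < 1 / 2) (hδ0 : 0 ≤ δ)
    (hδ : δ < 1 / 2) (C : ℝ) (k : ℕ) :
    ∀ᶠ n : ℕ in atTop, ∀ (D : PMF (Cube n)) (A : Learner n) (m q : ℕ),
      (∀ c ∈ Conjunctions n, Succeeds D (ρ n) ε δ c A) →
      A.ExamplesAtMost (fun _ => false) m → A.QueriesAtMost (fun _ => false) q →
      C * (n : ℝ) ^ k < m + q := by
  have hδ' : 0 < 1 - 2 * δ := by linarith
  filter_upwards [eventually_mul_pow_lt_two_pow (log_isLittleO_min_floor h0 hρ) (C / (1 - 2 * δ)) k,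
    eventually_gt_atTop 0] with n hlt hn D A m q hA hm hq
  obtain ⟨F, -, hF⟩ := Finset.exists_subset_card_eq (s := (Finset.univ : Finset (Fin n)))
    (n := min ⌊ρ n⌋₊ n) (by simp)
  have hFρ : (F.card : ℝ) ≤ ρ n :=
    (Nat.cast_le.2 (hF.trans_le (min_le_left _ _))).trans (Nat.floor_le (h0 n))
  rw [div_mul_eq_mul_div, div_lt_iff₀' hδ', ← hF] at hlt
  exact hlt.trans_le (mul_two_pow_card_le_of_succeeds hn hFρ hε hδ0 hA hm hq)

theorem eventually_eval_le_pow {σ : Type*} (p : MvPolynomial σ ℕ) {v : ℕ → σ → ℕ}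
    (hv : ∀ i, ∀ᶠ n in atTop, v n i ≤ n) :
    ∃ k, ∀ᶠ n in atTop, MvPolynomial.eval (v n) p ≤ n ^ k := by
  induction p using MvPolynomial.induction_on with
  | C a =>
    refine ⟨1, ?_⟩
    filter_upwards [eventually_ge_atTop a] with n hn
    simpa using hn
  | add p q hp hq =>
    obtain ⟨k, hk⟩ := hp
    obtain ⟨k', hk'⟩ := hq
    refine ⟨max k k' + 1, ?_⟩
    filter_upwards [hk, hk', eventually_ge_atTop 2] with n h h' hn
    have hn0 : 0 < n := two_pos.trans_le hn
    calc MvPolynomial.eval (v n) (p + q) ≤ n ^ k + n ^ k' := by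
          rw [map_add]
          exact add_le_add h h'
      _ ≤ n ^ max k k' + n ^ max k k' :=
          add_le_add (Nat.pow_le_pow_right hn0 (le_max_left k k'))
            (Nat.pow_le_pow_right hn0 (le_max_right k k'))
      _ = n ^ max k k' * 2 := (Nat.mul_two _).symm
      _ ≤ n ^ max k k' * n := Nat.mul_le_mul_left _ hn
  | mul_X p i hp =>
    obtain ⟨k, hk⟩ := hp
    refine ⟨k + 1, ?_⟩
    filter_upwards [hk, hv i] with n h hvi
    rw [map_mul, MvPolynomial.eval_X, pow_succ]
    exact Nat.mul_le_mul h hvi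

theorem eventually_polyBound_le_pow (p : MvPolynomial (Fin 3) ℕ) (ε δ : ℝ) :
    ∃ k, ∀ᶠ n in atTop, polyBound p n ε δ ≤ n ^ k := by
  refine eventually_eval_le_pow p (v := fun n => ![n, ⌈1 / ε⌉₊, ⌈1 / δ⌉₊]) fun i => ?_
  fin_cases i
  exacts [.of_forall fun n => le_rfl, eventually_ge_atTop _, eventually_ge_atTop _]

theorem not_sampleEfficientlyLearnable_conjunctions (D : ∀ n, PMF (Cube n)) (lam : ℕ → ℝ)
    {ρ : ℕ → ℝ} (h0 : ∀ n, 0 ≤ ρ n) (hρ : (fun n : ℕ => Real.log n) =o[atTop] ρ) :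
    ¬ SampleEfficientlyLearnable D Conjunctions lam ρ := by
  rintro ⟨A, p, hA⟩
  obtain ⟨k, hk⟩ := eventually_polyBound_le_pow p (1 / 4) (1 / 4)
  have hlower := eventually_mul_pow_lt_of_succeeds (ε := 1 / 4) (δ := 1 / 4) h0 hρ (by norm_num)
    (by norm_num) (by norm_num) 2 k
  obtain ⟨n, ⟨hpoly, hlower⟩, hn⟩ := ((hk.and hlower).and (eventually_gt_atTop 0)).exists
  have hAn := hA n (1 / 4) (1 / 4) (by norm_num) (by norm_num)
  obtain ⟨hm, hq, -⟩ := hAn _ (false_mem_conjunctions hn)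
  have hlt := hlower (D n) _ _ _ (fun c hc => (hAn c hc).2.2.2) hm hq
  have hle : (polyBound p n (1 / 4) (1 / 4) : ℝ) ≤ (n : ℝ) ^ k := by exact_mod_cast hpoly
  linarith

end LowerBound

end RobustLearning

theorem mainTheorem12_general :
    (∀ lam ρ : ℕ → ℝ, ρ =Θ[atTop] (fun n : ℕ => Real.log n) →
      IsRobustnessThreshold uniform Conjunctions lam ρ ∧
      PolyTimeLearnable uniform Conjunctions lam ρ) ∧
    (∀ ε < (1 / 2 : ℝ), ∀ δ ∈ Set.Ico (0 : ℝ) (1 / 2),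
      ∀ ρ : ℕ → ℝ, (∀ n, 0 ≤ ρ n) → (fun n : ℕ => Real.log n) =o[atTop] ρ →
        ∀ k : ℕ, ∀ᶠ n : ℕ in atTop, ∀ (D : PMF (Cube n)) (A : Learner n),
          (∀ c ∈ Conjunctions n, Succeeds D (ρ n) ε δ c A) →
          ∃ c ∈ Conjunctions n,
            ¬ (A.ExamplesAtMost c (n ^ k) ∧ A.QueriesAtMost c (n ^ k))) := by
  refine ⟨fun lam ρ hρ => ⟨⟨sampleEfficientlyLearnable_conjunctions lam hρ.1,
    fun ρ' h0 hρ' => not_sampleEfficientlyLearnable_conjunctions uniform lam h0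
      (hρ.2.trans_isLittleO hρ')⟩, polyTimeLearnable_conjunctions lam hρ.1⟩,
    fun ε hε δ hδ ρ h0 hρ k => ?_⟩
  filter_upwards [eventually_mul_pow_lt_of_succeeds h0 hρ hε hδ.1 hδ.2 2 k, eventually_gt_atTop 0]
    with n hlower hn D A hA
  refine ⟨_, false_mem_conjunctions hn, fun ⟨hm, hq⟩ => ?_⟩
  have hlt := hlower D A _ _ hA hm hq
  push_cast at hlt
  linarith

theorem mainTheorem12 :
    (∀ lam ρ : ℕ → ℝ, (∀ n, 0 ≤ ρ n) → ρ =Θ[atTop] (fun n : ℕ => Real.log n) →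
      IsRobustnessThreshold uniform Conjunctions lam ρ ∧
      PolyTimeLearnable uniform Conjunctions lam ρ) ∧
    (∃ ε : ℝ, 0 < ε ∧ ∃ δ : ℝ, 0 < δ ∧
      ∀ ρ : ℕ → ℝ, (∀ n, 0 ≤ ρ n) → (fun n : ℕ => Real.log n) =o[atTop] ρ →
        ∀ k : ℕ, ∀ᶠ n : ℕ in atTop, ∀ A : Learner n,
          (∀ c ∈ Conjunctions n, Succeeds (uniform n) (ρ n) ε δ c A) →
          ∃ c ∈ Conjunctions n,
            ¬ (A.ExamplesAtMost c (n ^ k) ∧ A.QueriesAtMost c (n ^ k))) := by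
  refine ⟨fun lam ρ _ hρ => mainTheorem12_general.1 lam ρ hρ,
    1 / 4, by norm_num, 1 / 4, by norm_num, fun ρ h0 hρ k =>
      (mainTheorem12_general.2 (1 / 4) (by norm_num) (1 / 4) (by norm_num) ρ h0 hρ k).mono
        fun n hn => hn (uniform n)⟩
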